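/- Let $K$ be an algebraically closed field, $Q$ a finite connected quiver in which at most two arrows start and at most two arrows end at each vertex, and $I$ an admissible ideal of the path algebra $KQ$ (that is, $R^m\subseteq I\subseteq R^2$ for some $m\ge 2$, where $R$ is the ideal generated by the arrows). Paths are composed from left to right. Suppose that $\Lambda=KQ/I$ is a tame symmetric algebra which is periodic of period four, i.e. $4$ is the smallest $d\ge 1$ with $\Omega^d_{\Lambda^e}(\Lambda)\cong\Lambda$ as $\Lambda$-bimodules. A minimal relation (minimal generator of $I$) from a vertex $a$ to a vertex $b$ is an element $\rho\in e_aIe_b$ (a linear combination of paths from $a$ to $b$ lying in $I$) with $\rho\notin IR+RI$. For a path $p$ in $Q$ write $p\prec I$ if $p$ occurs with nonzero coefficient in some minimal relation. Let $$u\stackrel{\delta}\longrightarrow i\stackrel{\alpha}\longrightarrow k\stackrel{\beta}\longrightarrow t\stackrel{\gamma}\longrightarrow j$$ be arrows of $Q$ (the vertices need not be distinct). If $\alpha\beta\not\prec I$ or $\beta\gamma\not\prec I$, and $\alpha\beta\gamma\prec I$, then there is an arrow $j\to i$ in $Q$; thus $\alpha,\beta,\gamma$ together with this arrow form a square in $Q$.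 -/

import Mathlib

open scoped TensorProduct Polynomial

noncomputable section

universe u v w

/-! ### Path algebras -/

/-- All paths of a quiver, including the path of length zero at each vertex. -/
abbrev QPath (V : Type u) [Quiver.{v} V] : Type (max u v) :=
  Σ a b : V, Quiver.Path a b

/-- The underlying vector space of the path algebra `KQ`: the paths form a `K`-basis. -/
def PathAlgebra (K : Type w) [Field K] (V : Type u) [Quiver.{v} V] : Type (max u v w) :=
  QPath V →₀ K

namespace PathAlgebra

variable {K : Type w} [Field K] {V : Type u} [Quiver.{v} V]

instance : AddCommGroup (PathAlgebra K V) := inferInstanceAs (AddCommGroup (QPath V →₀ K))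

instance : Module K (PathAlgebra K V) := inferInstanceAs (Module K (QPath V →₀ K))

/-- The coefficient of the path `p` in `x`. -/
def coeff (x : PathAlgebra K V) {a b : V} (p : Quiver.Path a b) : K :=
  (show QPath V →₀ K from x) ⟨a, b, p⟩

variable (K) in
/-- A path, as an element of the path algebra. -/
def ofPath {a b : V} (p : Quiver.Path a b) : PathAlgebra K V :=
  Finsupp.single (⟨a, b, p⟩ : QPath V) (1 : K)

open Classical in
variable (K) in
/-- Product of two paths, written from left to right: `p q` is `p` followed by `q` if `p` ends
where `q` starts, and `0` otherwise. -/
def pathMul (p q : QPath V) : PathAlgebra K V :=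
  if h : p.2.1 = q.1 then ofPath K (p.2.2.comp (q.2.2.cast h.symm rfl)) else 0

variable (K V) in
/-- The bilinear extension of `pathMul`. -/
def mulHom : PathAlgebra K V →ₗ[K] PathAlgebra K V →ₗ[K] PathAlgebra K V :=
  Finsupp.linearCombination K fun p : QPath V =>
    (Finsupp.linearCombination K fun q : QPath V => pathMul K p q :
      (QPath V →₀ K) →ₗ[K] PathAlgebra K V)

instance : Mul (PathAlgebra K V) := ⟨fun x y => mulHom K V x y⟩

instance [Fintype V] : One (PathAlgebra K V) :=
  ⟨∑ a : V, ofPath K (Quiver.Path.nil : Quiver.Path a a)⟩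

theorem mul_def (x y : PathAlgebra K V) : x * y = mulHom K V x y := rfl

theorem ofPath_mul_ofPath {a b c d : V} (p : Quiver.Path a b) (q : Quiver.Path c d) :
    ofPath K p * ofPath K q = pathMul K ⟨a, b, p⟩ ⟨c, d, q⟩ := by
  rw [mul_def, mulHom, ofPath, ofPath]
  erw [Finsupp.linearCombination_single, one_smul]
  erw [Finsupp.linearCombination_single, one_smul]

theorem ofPath_mul_comp {a b c : V} (p : Quiver.Path a b) (q : Quiver.Path b c) :
    ofPath K p * ofPath K q = ofPath K (p.comp q) := by
  rw [ofPath_mul_ofPath, pathMul, dif_pos rfl]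
  rfl

theorem ofPath_mul_of_ne {a b c d : V} (p : Quiver.Path a b) (q : Quiver.Path c d) (h : b ≠ c) :
    ofPath K p * ofPath K q = 0 := by
  rw [ofPath_mul_ofPath, pathMul, dif_neg h]

theorem induction_on {P : PathAlgebra K V → Prop} (x : PathAlgebra K V) (h0 : P 0)
    (hadd : ∀ x y, P x → P y → P (x + y))
    (hp : ∀ (c : K) (a b : V) (p : Quiver.Path a b), P (c • ofPath K p)) : P x := by
  refine Finsupp.induction_linear (motive := fun x : QPath V →₀ K => P x) x h0 hadd ?_
  rintro ⟨a, b, p⟩ c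
  have := hp c a b p
  rw [ofPath] at this
  erw [Finsupp.smul_single, smul_eq_mul, mul_one] at this
  exact this

theorem add_mul_aux (x y z : PathAlgebra K V) : (x + y) * z = x * z + y * z := by
  simp only [mul_def, map_add, LinearMap.add_apply]

theorem mul_add_aux (x y z : PathAlgebra K V) : x * (y + z) = x * y + x * z := by
  simp only [mul_def, map_add]

theorem smul_mul_aux (c : K) (x y : PathAlgebra K V) : (c • x) * y = c • (x * y) := by
  simp only [mul_def, map_smul, LinearMap.smul_apply]

theorem mul_smul_aux (c : K) (x y : PathAlgebra K V) : x * (c • y) = c • (x * y) := by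
  simp only [mul_def, map_smul]

theorem zero_mul_aux (x : PathAlgebra K V) : 0 * x = 0 := by
  simp only [mul_def, map_zero, LinearMap.zero_apply]

theorem mul_zero_aux (x : PathAlgebra K V) : x * 0 = 0 := by
  simp only [mul_def, map_zero]

theorem mul_assoc_aux (x y z : PathAlgebra K V) : x * y * z = x * (y * z) := by
  refine induction_on (P := fun x => x * y * z = x * (y * z)) x (by simp only [zero_mul_aux]) ?_ ?_
  · intro x x' h h'
    simp only [add_mul_aux, h, h']
  intro c a b p
  refine induction_on (P := fun y => (c • ofPath K p) * y * z = (c • ofPath K p) * (y * z)) y (by simp only [zero_mul_aux, mul_zero_aux]) ?_ ?_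
  · intro x x' h h'
    simp only [add_mul_aux, mul_add_aux, h, h']
  intro c' a' b' p'
  refine induction_on (P := fun z => (c • ofPath K p) * (c' • ofPath K p') * z =
    (c • ofPath K p) * ((c' • ofPath K p') * z)) z (by simp only [mul_zero_aux]) ?_ ?_
  · intro x x' h h'
    simp only [mul_add_aux, h, h']
  intro c'' a'' b'' p''
  simp only [smul_mul_aux, mul_smul_aux]
  congr 3
  by_cases h : b = a'
  · subst h
    by_cases h' : b' = a''
    · subst h'
      simp only [ofPath_mul_comp, Quiver.Path.comp_assoc]
    · simp only [ofPath_mul_comp, ofPath_mul_of_ne _ _ h', mul_zero_aux]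
  · by_cases h' : b' = a''
    · subst h'
      simp only [ofPath_mul_comp, ofPath_mul_of_ne _ _ h, zero_mul_aux]
    · simp only [ofPath_mul_of_ne _ _ h, ofPath_mul_of_ne _ _ h', zero_mul_aux, mul_zero_aux]

theorem sum_mul_aux {ι : Type*} (s : Finset ι) (f : ι → PathAlgebra K V)
    (x : PathAlgebra K V) : (∑ i ∈ s, f i) * x = ∑ i ∈ s, f i * x := by
  simp only [mul_def, map_sum, LinearMap.sum_apply]

theorem mul_sum_aux {ι : Type*} (s : Finset ι) (f : ι → PathAlgebra K V)
    (x : PathAlgebra K V) : x * (∑ i ∈ s, f i) = ∑ i ∈ s, x * f i := by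
  simp only [mul_def, map_sum]

theorem one_mul_aux [Fintype V] (x : PathAlgebra K V) : 1 * x = x := by
  refine induction_on (P := fun x => 1 * x = x) x (by simp only [mul_zero_aux]) ?_ ?_
  · intro x x' h h'
    simp only [mul_add_aux, h, h']
  intro c a b p
  rw [mul_smul_aux]
  congr 1
  change (∑ a : V, ofPath K (Quiver.Path.nil : Quiver.Path a a)) * _ = _
  rw [sum_mul_aux, Finset.sum_eq_single a]
  · rw [ofPath_mul_comp, Quiver.Path.nil_comp]
  · intro b _ hb
    exact ofPath_mul_of_ne _ _ hb
  · simp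

theorem mul_one_aux [Fintype V] (x : PathAlgebra K V) : x * 1 = x := by
  refine induction_on (P := fun x => x * 1 = x) x (by simp only [zero_mul_aux]) ?_ ?_
  · intro x x' h h'
    simp only [add_mul_aux, h, h']
  intro c a b p
  rw [smul_mul_aux]
  congr 1
  change _ * (∑ a : V, ofPath K (Quiver.Path.nil : Quiver.Path a a)) = _
  rw [mul_sum_aux, Finset.sum_eq_single b]
  · rw [ofPath_mul_comp, Quiver.Path.comp_nil]
  · intro c _ hc
    exact ofPath_mul_of_ne _ _ hc.symm
  · simp

instance [Fintype V] : Ring (PathAlgebra K V) :=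
  { (inferInstance : AddCommGroup (PathAlgebra K V)) with
    left_distrib := mul_add_aux
    right_distrib := add_mul_aux
    zero_mul := zero_mul_aux
    mul_zero := mul_zero_aux
    mul_assoc := mul_assoc_aux
    one_mul := one_mul_aux
    mul_one := mul_one_aux }

instance [Fintype V] : Algebra K (PathAlgebra K V) :=
  Algebra.ofModule smul_mul_aux mul_smul_aux

end PathAlgebra

/-! ### Admissible ideals, minimal relations -/

section Relations

variable (K : Type w) [Field K] (V : Type u) [Quiver.{v} V]

/-- The arrow ideal of `KQ`: the span of all paths of length at least one. -/
def arrowIdeal : Submodule K (PathAlgebra K V) :=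
  Submodule.span K {x | ∃ (a b : V) (p : Quiver.Path a b), 1 ≤ p.length ∧
    x = PathAlgebra.ofPath K p}

variable {K V} [Fintype V]

/-- A two-sided ideal `I` of `KQ` is admissible if `R ^ m ⊆ I ⊆ R ^ 2` for some `m ≥ 2`,
where `R` is the arrow ideal. -/
def IsAdmissible (I : Ideal (PathAlgebra K V)) : Prop :=
  I.restrictScalars K ≤ arrowIdeal K V ^ 2 ∧
    ∃ m : ℕ, 2 ≤ m ∧ arrowIdeal K V ^ m ≤ I.restrictScalars K

/-- `ρ` is a minimal relation from `a` to `b`, that is, a minimal generator of the ideal `I`: a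
linear combination of paths from `a` to `b` that lies in `I` but not in `I R + R I`. -/
def IsMinimalRelation (I : Ideal (PathAlgebra K V)) (a b : V) (ρ : PathAlgebra K V) : Prop :=
  ρ ∈ I ∧
  (∀ (c d : V) (p : Quiver.Path c d), ρ.coeff p ≠ 0 → c = a ∧ d = b) ∧
  ρ ∉ I.restrictScalars K * arrowIdeal K V + arrowIdeal K V * I.restrictScalars K

/-- `p ≺ I`: the path `p` occurs, with nonzero coefficient, in some minimal relation. -/
def OccursInMinimalRelation (I : Ideal (PathAlgebra K V)) {a b : V} (p : Quiver.Path a b) :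
    Prop :=
  ∃ ρ : PathAlgebra K V, IsMinimalRelation I a b ρ ∧ ρ.coeff p ≠ 0

end Relations

/-! ### Shape of the quiver -/

/-- The underlying graph of the quiver is connected. -/
def QuiverConnected (V : Type u) [Quiver.{v} V] : Prop :=
  Nonempty V ∧
    ∀ a b : V, Nonempty (Quiver.Path (V := Quiver.Symmetrify V) a b)

/-- At each vertex at most two arrows start and at most two arrows end. -/
def QuiverBiserial (V : Type u) [Quiver.{v} V] : Prop :=
  ∀ i : V, ENat.card (Σ j : V, (i ⟶ j)) ≤ 2 ∧ ENat.card (Σ j : V, (j ⟶ i)) ≤ 2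

/-! ### Symmetric algebras -/

/-- A finite-dimensional algebra is symmetric if it has a nondegenerate symmetric associative
bilinear form. -/
def IsSymmetricAlg (K : Type w) [Field K] (A : Type u) [Ring A] [Algebra K A] : Prop :=
  Module.Finite K A ∧ ∃ B : LinearMap.BilinForm K A,
    B.Nondegenerate ∧ (∀ x y, B x y = B y x) ∧ ∀ x y z, B (x * y) z = B x (y * z)

/-! ### Periodic algebras -/

/-- `N` is a (first) syzygy of `M`: it is isomorphic to the kernel of a projective cover
`π : P → M`, i.e. of a surjection from a projective module whose kernel is superfluous. -/
def IsSyzygy (E : Type u) [Ring E] (M N : Type u) [AddCommGroup M] [Module E M]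
    [AddCommGroup N] [Module E N] : Prop :=
  ∃ (P : Type u) (_ : AddCommGroup P) (_ : Module E P) (π : P →ₗ[E] M),
    Module.Projective E P ∧ Function.Surjective π ∧
    (∀ L : Submodule E P, L ⊔ LinearMap.ker π = ⊤ → L = ⊤) ∧
    Nonempty (N ≃ₗ[E] LinearMap.ker π)

/-- `N ≅ Ω ^ n (M)`. -/
def IsNthSyzygy (E : Type u) [Ring E] : ℕ → ∀ (M N : Type u) [AddCommGroup M] [Module E M]
    [AddCommGroup N] [Module E N], Prop
  | 0, M, N, _, _, _, _ => Nonempty (N ≃ₗ[E] M)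
  | n + 1, M, N, _, _, _, _ => ∃ (L : Type u) (_ : AddCommGroup L) (_ : Module E L),
      IsNthSyzygy E n M L ∧ IsSyzygy E L N

/-- `d` is the period of the module `M`: the least `d ≥ 1` with `Ω ^ d (M) ≅ M`. -/
def HasPeriod (E : Type u) [Ring E] (M : Type u) [AddCommGroup M] [Module E M] (d : ℕ) : Prop :=
  IsLeast {n : ℕ | 1 ≤ n ∧ IsNthSyzygy E n M M} d

/-- `A` is a periodic algebra of period `d`: it has period `d` as a bimodule over itself, i.e. as a
module over the enveloping algebra `A ⊗ Aᵒᵖ`, with `(a ⊗ b) • x = a x b`. -/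
def IsPeriodicAlg (K : Type w) [Field K] (A : Type u) [Ring A] [Algebra K A] (d : ℕ) :
    Prop :=
  letI : Module (A ⊗[K] Aᵐᵒᵖ) A := TensorProduct.Algebra.module
  HasPeriod (A ⊗[K] Aᵐᵒᵖ) A d

/-! ### Tame algebras -/

/-- A nonzero module which is not a direct sum of two nonzero submodules. -/
def IsIndecomposableMod (E : Type u) [Ring E] (M : Type v) [AddCommGroup M] [Module E M] : Prop :=
  Nontrivial M ∧ ∀ N L : Submodule E M, IsCompl N L → N = ⊥ ∨ L = ⊥

/-- The right `A`-module structure on the space of row vectors `K ^ d` given by a matrix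
representation `σ`, namely `v · a = v σ(a)`, is isomorphic to the right `A`-module `M`. -/
def RealizedBy {K : Type w} [Field K] {A : Type u} [Ring A] [Algebra K A] {d : ℕ}
    (M : Type v) [AddCommGroup M] [Module K M] [Module Aᵐᵒᵖ M]
    (σ : A →ₐ[K] Matrix (Fin d) (Fin d) K) : Prop :=
  ∃ f : M ≃ₗ[K] (Fin d → K), ∀ (a : A) (m : M),
    f (MulOpposite.op a • m) = Matrix.vecMul (f m) (σ a)

/-- The specialization at `x = c` of a matrix representation over `K[x]`. -/
def specialize {K : Type w} [Field K] {A : Type u} [Ring A] [Algebra K A] {d : ℕ}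
    (τ : A →ₐ[K] Matrix (Fin d) (Fin d) K[X]) (c : K) : A →ₐ[K] Matrix (Fin d) (Fin d) K :=
  (Polynomial.aeval c : K[X] →ₐ[K] K).mapMatrix.comp τ

/-- Tameness: in each dimension `d`, all but finitely many isomorphism classes of indecomposable
right `A`-modules of dimension `d` are of the form `K[x]/(x - c) ⊗ M` with `M` from a finite list of
`K[x]`-`A`-bimodules which are free of finite rank over `K[x]`. Such a bimodule of rank `d` is, after
the choice of a `K[x]`-basis, an algebra homomorphism `τ` from `A` to the `d × d` matrices over
`K[x]` (acting on row vectors from the right), and `K[x]/(x - c) ⊗ M` is its specialization at `c`;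
only bimodules of rank `d` contribute modules of dimension `d`. -/
def IsTame (K : Type w) [Field K] (A : Type u) [Ring A] [Algebra K A] : Prop :=
  ∀ d : ℕ, ∃ (S : Set (A →ₐ[K] Matrix (Fin d) (Fin d) K))
    (T : Set (A →ₐ[K] Matrix (Fin d) (Fin d) K[X])), S.Finite ∧ T.Finite ∧
    ∀ (M : Type u) [AddCommGroup M] [Module K M] [Module Aᵐᵒᵖ M] [IsScalarTower K Aᵐᵒᵖ M],
      Module.Finite K M → Module.finrank K M = d → IsIndecomposableMod Aᵐᵒᵖ M →
      (∃ σ ∈ S, RealizedBy M σ) ∨ ∃ τ ∈ T, ∃ c : K, RealizedBy M (specialize τ c)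

/-- TSP4 algebras: tame symmetric algebras which are periodic of period four. -/
structure IsTSP4 (K : Type w) [Field K] (A : Type u) [Ring A] [Algebra K A] : Prop where
  tame : IsTame K A
  symmetric : IsSymmetricAlg K A
  periodic : IsPeriodicAlg K A 4

end

/-!
A minimal relation from `a` to `b` contributes a copy of the projective cover of the simple bimodule
`S` attached to `a` and `b` to the term `P₂` of the minimal resolution of `Λ` over
`Λᵉ = Λ ⊗ Λᵐᵒᵖ`. Since `Λᵉ` is symmetric, the socle of this copy is a copy of `S` inside `Ω³Λ`. As
`Ω³Λ` is the quotient of `P₃` by `Ω⁴Λ ≅ Λ`, such copies are detected by `Ext¹(S, Λ)`. By duality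
this is `Ext¹(Λ, S*)`, the space of outer derivations of `Λ` into `S*`, and it vanishes unless there
is an arrow from `b` to `a`.
-/

open MulOpposite

/-! ### Symmetrizing traces -/

section SymmetrizingTrace

variable {K A B : Type*} [Field K] [Ring A] [Algebra K A] [Ring B] [Algebra K B]

/-- A symmetrizing trace of a `K`-algebra `A`: a symmetric functional for which
`x ↦ T (x * ·)` identifies `A` with its dual. A finite-dimensional algebra is symmetric if and only
if it has one. -/
structure IsSymmetrizingTrace (T : A →ₗ[K] K) : Prop where
  comm : ∀ x y, T (x * y) = T (y * x)
  bijective : Function.Bijective ((LinearMap.mul K A).compr₂ T)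

theorem IsSymmetricAlg.exists_isSymmetrizingTrace (h : IsSymmetricAlg K A) :
    ∃ T : A →ₗ[K] K, IsSymmetrizingTrace T := by
  obtain ⟨_, B, hB, hcomm, hassoc⟩ := h
  have hmul : ∀ x y, B 1 (x * y) = B x y := fun x y => by rw [← hassoc, one_mul]
  have hcompr : (LinearMap.mul K A).compr₂ (B 1) = B := LinearMap.ext₂ hmul
  exact ⟨B 1, fun x y => by rw [hmul, hmul, hcomm], by rw [hcompr]; exact (B.toDual hB).bijective⟩

namespace IsSymmetrizingTrace

variable {T : A →ₗ[K] K} {T' : B →ₗ[K] K}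

theorem ext (hT : IsSymmetrizingTrace T) {x y : A} (h : ∀ z, T (x * z) = T (y * z)) : x = y :=
  hT.bijective.1 (LinearMap.ext h)

theorem exists_repr (hT : IsSymmetrizingTrace T) (f : A →ₗ[K] K) : ∃ x, ∀ y, T (x * y) = f y :=
  (hT.bijective.2 f).imp fun _ hx y => LinearMap.congr_fun hx y

theorem comp_unop (hT : IsSymmetrizingTrace T) :
    IsSymmetrizingTrace (T ∘ₗ (opLinearEquiv K).symm.toLinearMap : Aᵐᵒᵖ →ₗ[K] K) where
  comm x y := hT.comm y.unop x.unop
  bijective := by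
    let e : A ≃ₗ[K] Aᵐᵒᵖ := opLinearEquiv K
    convert (e.dualMap.symm.bijective.comp hT.bijective).comp e.symm.bijective using 1
    ext x y
    exact hT.comm _ _

theorem dualDistrib_tmul [Module.Finite K A] [Module.Finite K B] (hT : IsSymmetrizingTrace T)
    (hT' : IsSymmetrizingTrace T') :
    IsSymmetrizingTrace (TensorProduct.dualDistrib K A B (T ⊗ₜ T')) where
  comm x y := by
    induction x with
    | zero => simp
    | add x x' hx hx' => simp only [add_mul, mul_add, map_add, hx, hx']
    | tmul a b =>
      induction y with
      | zero => simp
      | add y y' hy hy' => simp only [add_mul, mul_add, map_add, hy, hy']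
      | tmul a' b' => simp [hT.comm a, hT'.comm b]
  bijective := by
    let e := LinearEquiv.ofBijective _ hT.bijective
    let e' := LinearEquiv.ofBijective _ hT'.bijective
    let f := (TensorProduct.congr e e').trans (TensorProduct.dualDistribEquiv K A B)
    have hf : (LinearMap.mul K (A ⊗[K] B)).compr₂ (TensorProduct.dualDistrib K A B (T ⊗ₜ T')) =
        f.toLinearMap := TensorProduct.ext' fun a b => TensorProduct.ext' fun a' b' => by
      simp [f, e, e', TensorProduct.dualDistribEquiv]
    rw [hf]
    exact f.bijective

end IsSymmetrizingTrace

/-- The left ideal `J` and the element `s` of `E` are related by two annihilator conditions: `J` is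
the right-hand annihilator of `s`, and the elements killed by `J` are the right multiples of `s`. In
a symmetric algebra this holds for the kernel `J` of a character and the socle element `s` on which
the algebra acts through that character. -/
structure IsAnnihilatorPair {E : Type*} [Ring E] (J : Ideal E) (s : E) : Prop where
  mul_eq_zero_iff : ∀ e, s * e = 0 ↔ e ∈ J
  forall_mul_eq_zero_iff : ∀ y, (∀ e ∈ J, e * y = 0) ↔ ∃ c, y = s * c

theorem IsSymmetrizingTrace.exists_isAnnihilatorPair_ker {T : A →ₗ[K] K}
    (hT : IsSymmetrizingTrace T) (χ : A →ₐ[K] K) :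
    ∃ s, IsAnnihilatorPair (RingHom.ker χ) s := by
  obtain ⟨s, hs⟩ := hT.exists_repr χ.toLinearMap
  replace hs : ∀ y, T (s * y) = χ y := hs
  have hright : ∀ e, s * e = χ e • s := fun e => hT.ext fun z => by
    rw [mul_assoc, hs, smul_mul_assoc, map_smul, hs, map_mul, smul_eq_mul]
  have hleft : ∀ e, e * s = χ e • s := fun e => hT.ext fun z => by
    rw [mul_assoc, hT.comm, mul_assoc, hs, smul_mul_assoc, map_smul, hs, map_mul, smul_eq_mul,
      mul_comm]
  have hne : s ≠ 0 := fun h => one_ne_zero (α := K) <| by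
    rw [← map_one χ, ← hs, h, zero_mul, map_zero]
  refine ⟨s, fun e => ?_, fun y => ⟨fun hy => ⟨algebraMap K A (T y), ?_⟩, ?_⟩⟩
  · rw [hright, smul_eq_zero, or_iff_left hne, RingHom.mem_ker]
  · refine hT.ext fun z => ?_
    have hz : (z - algebraMap K A (χ z)) * y = 0 := hy _ (by simp [RingHom.mem_ker])
    rw [sub_mul, sub_eq_zero, ← Algebra.smul_def] at hz
    rw [hT.comm y, hz, map_smul, mul_assoc, hs, map_mul, AlgHom.commutes, Algebra.algebraMap_self,
      RingHom.id_apply, smul_eq_mul, mul_comm]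
  · rintro ⟨c, rfl⟩ e he
    rw [← mul_assoc, hleft, RingHom.mem_ker.1 he, zero_smul, zero_mul]

end SymmetrizingTrace

/-! ### Dimension shifting at an annihilator pair -/

section DimensionShift

variable {E : Type*} [Ring E] {J : Ideal E} {s : E}
  {M N P : Type*} [AddCommGroup M] [AddCommGroup N] [AddCommGroup P] [Module E M] [Module E N]
  [Module E P]

namespace IsAnnihilatorPair

theorem mem_smul_top_of_smul_eq_zero [Module.Projective E P] (h : IsAnnihilatorPair J s) {q : P}
    (hq : s • q = 0) : q ∈ J • (⊤ : Submodule E P) := by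
  obtain ⟨σ, hσ⟩ := Module.projective_def'.1 ‹Module.Projective E P›
  have hJ : ∀ y, σ q y ∈ J := fun y => by
    rw [← h.mul_eq_zero_iff, ← smul_eq_mul, ← Finsupp.smul_apply, ← map_smul, hq, map_zero,
      Finsupp.zero_apply]
  rw [← LinearMap.id_apply (R := E) q, ← hσ, LinearMap.comp_apply, Finsupp.linearCombination_apply]
  exact Submodule.sum_mem _ fun y _ => Submodule.smul_mem_smul (hJ y) Submodule.mem_top

theorem exists_eq_smul_of_forall_smul_eq_zero [Module.Projective E P] (h : IsAnnihilatorPair J s)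
    {q : P} (hq : ∀ e ∈ J, e • q = 0) : ∃ w, q = s • w := by
  obtain ⟨σ, hσ⟩ := Module.projective_def'.1 ‹Module.Projective E P›
  have hs : ∀ y, ∃ c, σ q y = s * c := fun y => (h.forall_mul_eq_zero_iff _).1 fun e he => by
    rw [← smul_eq_mul, ← Finsupp.smul_apply, ← map_smul, hq e he, map_zero, Finsupp.zero_apply]
  choose c hc using hs
  refine ⟨∑ y ∈ (σ q).support, c y • y, ?_⟩
  conv_lhs => rw [← LinearMap.id_apply (R := E) q, ← hσ]
  simp only [LinearMap.comp_apply, Finsupp.linearCombination_apply, Finsupp.sum, hc, mul_smul,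
    Finset.smul_sum, id_eq]

theorem smul_eq_zero_of_mem_smul (h : IsAnnihilatorPair J s) {L : Submodule E M} {x : M}
    (hx : x ∈ J • L) : s • x = 0 :=
  Submodule.smul_induction_on hx
    (fun e he y _ => by rw [smul_smul, (h.mul_eq_zero_iff e).2 he, zero_smul])
    fun x y hx hy => by rw [smul_add, hx, hy, add_zero]

theorem mem_smul_range (h : IsAnnihilatorPair J s) {ι : M →ₗ[E] P} (hι : Function.Injective ι)
    (hM : ∀ m : M, s • m = 0 → m ∈ J • (⊤ : Submodule E M)) {x : P} (hx : x ∈ LinearMap.range ι)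
    (hxJ : x ∈ J • (⊤ : Submodule E P)) : x ∈ J • LinearMap.range ι := by
  obtain ⟨m, rfl⟩ := hx
  have hm : s • m = 0 := hι <| by rw [map_smul, h.smul_eq_zero_of_mem_smul hxJ, map_zero]
  rw [LinearMap.range_eq_map, ← Submodule.map_smul'']
  exact Submodule.mem_map_of_mem (hM m hm)

end IsAnnihilatorPair

/-- Baer's extension condition for `M` at a single left ideal `J`, equivalent to
`Ext¹(E ⧸ J, M) = 0`. -/
def IsBaerAt (J : Ideal E) (M : Type*) [AddCommGroup M] [Module E M] : Prop :=
  ∀ θ : J →ₗ[E] M, ∃ m : M, ∀ e : J, θ e = (e : E) • m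

variable {ι : M →ₗ[E] P} {π : P →ₗ[E] N}

theorem IsBaerAt.exists_eq_smul_of_exact [Module.Projective E P] (hM : IsBaerAt J M)
    (hJs : IsAnnihilatorPair J s) (hι : Function.Injective ι) (hιπ : Function.Exact ι π)
    (hπ : Function.Surjective π) {n : N} (hn : ∀ e ∈ J, e • n = 0) : ∃ m, n = s • m := by
  obtain ⟨v, rfl⟩ := hπ n
  have hrange : ∀ e : J, (e : E) • v ∈ LinearMap.range ι := fun e =>
    (hιπ _).1 (by rw [map_smul, hn e e.2])
  let θ : J →ₗ[E] M := (LinearEquiv.ofInjective ι hι).symm.toLinearMap ∘ₗ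
    ((LinearMap.toSpanSingleton E P v).domRestrict J).codRestrict (LinearMap.range ι) hrange
  have hθ : ∀ e : J, ι (θ e) = (e : E) • v := fun e =>
    congrArg Subtype.val ((LinearEquiv.ofInjective ι hι).apply_symm_apply ⟨_, hrange e⟩)
  obtain ⟨m, hm⟩ := hM θ
  obtain ⟨w, hw⟩ := hJs.exists_eq_smul_of_forall_smul_eq_zero (q := v - ι m) fun e he => by
    rw [smul_sub, ← map_smul, ← hm ⟨e, he⟩, hθ, sub_self]
  exact ⟨π w, by rw [← map_smul, ← hw, map_sub, hιπ.apply_apply_eq_zero, sub_zero]⟩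

theorem IsAnnihilatorPair.mem_smul_top_of_exact [Module.Projective E P]
    (hJs : IsAnnihilatorPair J s) (hι : Function.Injective ι) (hιπ : Function.Exact ι π)
    (hπ : Function.Surjective π) (hM : ∀ m : M, (∀ e ∈ J, e • m = 0) → ∃ w, m = s • w) {n : N}
    (hn : s • n = 0) : n ∈ J • (⊤ : Submodule E N) := by
  obtain ⟨q, rfl⟩ := hπ n
  obtain ⟨m, hm⟩ := (hιπ (s • q)).1 (by rw [map_smul, hn])
  have hJm : ∀ e ∈ J, e • m = 0 := fun e he => hι <| by
    rw [map_smul, hm, smul_smul, (hJs.forall_mul_eq_zero_iff s).2 ⟨1, (mul_one s).symm⟩ e he,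
      zero_smul, map_zero]
  obtain ⟨w, rfl⟩ := hM m hJm
  have hq : q - ι w ∈ J • (⊤ : Submodule E P) := hJs.mem_smul_top_of_smul_eq_zero <| by
    rw [smul_sub, ← hm, map_smul, sub_self]
  have := Submodule.mem_map_of_mem (f := π) hq
  rw [map_sub, hιπ.apply_apply_eq_zero, sub_zero, Submodule.map_smul''] at this
  exact Submodule.smul_mono le_rfl le_top this

end DimensionShift

/-! ### The enveloping algebra -/

section Enveloping

variable {K Λ : Type*} [Field K] [Ring Λ] [Algebra K Λ]

attribute [local instance] instModuleTensorProductMop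

theorem tmul_op_smul (a b x : Λ) : (a ⊗ₜ[K] op b) • x = a * x * b := by
  rw [TensorProduct.Algebra.smul_def, smul_eq_mul, op_smul_eq_mul, mul_assoc]

theorem enveloping_isScalarTower : IsScalarTower K (Λ ⊗[K] Λᵐᵒᵖ) Λ where
  smul_assoc c e x := LinearMap.congr_fun (map_smul (AlgHom.mulLeftRight K Λ) c e) x

attribute [local instance] enveloping_isScalarTower

/-- The character `a ⊗ b ↦ ε a * ε' b` of the enveloping algebra, which is its action on the simple
bimodule attached to the characters `ε` and `ε'`. -/
noncomputable def envChar (ε ε' : Λ →ₐ[K] K) : Λ ⊗[K] Λᵐᵒᵖ →ₐ[K] K :=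
  Algebra.TensorProduct.lift ε (ε'.fromOpposite fun _ _ => Commute.all _ _) fun _ _ =>
    Commute.all _ _

@[simp]
theorem envChar_tmul (ε ε' : Λ →ₐ[K] K) (a : Λ) (b : Λᵐᵒᵖ) :
    envChar ε ε' (a ⊗ₜ b) = ε a * ε' b.unop := by
  simp [envChar]

/-- The evaluation `a ⊗ b ↦ ε a • b` of the left factor of the enveloping algebra. -/
noncomputable def envRight (ε : Λ →ₐ[K] K) : Λ ⊗[K] Λᵐᵒᵖ →ₐ[K] Λᵐᵒᵖ :=
  (Algebra.TensorProduct.lid K Λᵐᵒᵖ).toAlgHom.comp (Algebra.TensorProduct.map ε (.id K Λᵐᵒᵖ))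

@[simp]
theorem envRight_tmul (ε : Λ →ₐ[K] K) (a : Λ) (b : Λᵐᵒᵖ) : envRight ε (a ⊗ₜ b) = ε a • b := by
  simp [envRight]

theorem char_unop_envRight (ε ε' : Λ →ₐ[K] K) (e : Λ ⊗[K] Λᵐᵒᵖ) :
    ε' (envRight ε e).unop = envChar ε ε' e := by
  induction e with
  | zero => simp
  | tmul a b => simp
  | add x y hx hy => simp [hx, hy]

theorem char_smul (ε : Λ →ₐ[K] K) (e : Λ ⊗[K] Λᵐᵒᵖ) (x : Λ) :
    ε (e • x) = envChar ε ε e * ε x := by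
  change ε (AlgHom.mulLeftRight K Λ e x) = _
  induction e with
  | zero => simp
  | tmul a b => simp [mul_right_comm]
  | add e f he hf => simp [he, hf, add_mul]

variable (K) in
/-- The universal derivation `a ↦ a ⊗ 1 - 1 ⊗ a` of `Λ` into the enveloping algebra. -/
noncomputable def envDiff : Λ →ₗ[K] Λ ⊗[K] Λᵐᵒᵖ :=
  (TensorProduct.mk K Λ Λᵐᵒᵖ).flip 1 - TensorProduct.mk K Λ Λᵐᵒᵖ 1 ∘ₗ (opLinearEquiv K).toLinearMap

theorem envDiff_apply (a : Λ) : envDiff K a = a ⊗ₜ 1 - 1 ⊗ₜ op a := rfl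

theorem envDiff_mul_right (x y : Λ) :
    envDiff K (x * y) = envDiff K x * y ⊗ₜ 1 + envDiff K y * 1 ⊗ₜ op x := by
  simp [envDiff_apply, sub_mul]

theorem envDiff_mul_left (x y : Λ) :
    envDiff K (x * y) = x ⊗ₜ 1 * envDiff K y + 1 ⊗ₜ op y * envDiff K x := by
  simp [envDiff_apply, mul_sub]

@[simp]
theorem envChar_envDiff (ε ε' : Λ →ₐ[K] K) (a : Λ) :
    envChar ε ε' (envDiff K a) = ε a - ε' a := by
  simp [envDiff_apply]

@[simp]
theorem envRight_envDiff (ε : Λ →ₐ[K] K) (a : Λ) :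
    envRight ε (envDiff K a) = ε a • 1 - op a := by
  simp [envDiff_apply]

theorem envDiff_smul (a x : Λ) : envDiff K a • x = a * x - x * a := by
  rw [envDiff_apply, sub_smul, ← op_one, tmul_op_smul, tmul_op_smul, mul_one, one_mul]

/-- Every `(ε', ε)`-derivation of `Λ` is inner, that is, `HH¹(Λ, S) = 0` for the simple bimodule `S`
attached to the characters `ε'` and `ε`. -/
def DerivationsInner (ε' ε : Λ →ₐ[K] K) : Prop :=
  ∀ g : Λ →ₗ[K] K, (∀ a b, g (a * b) = ε' a * g b + ε b * g a) → ∃ c, ∀ a, g a = c * (ε' a - ε a)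

theorem DerivationsInner.of_surjective {A : Type*} [Ring A] [Algebra K A] {π : A →ₐ[K] Λ}
    (hπ : Function.Surjective π) {ε' ε : Λ →ₐ[K] K}
    (h : DerivationsInner (ε'.comp π) (ε.comp π)) : DerivationsInner ε' ε := by
  intro g hg
  obtain ⟨c, hc⟩ := h (g ∘ₗ π.toLinearMap) fun x y => by
    simpa using hg (π x) (π y)
  exact ⟨c, hπ.forall.2 hc⟩

variable {T : Λ →ₗ[K] K} {ε ε' : Λ →ₐ[K] K}

theorem IsSymmetrizingTrace.exists_apply_smul_eq (hT : IsSymmetrizingTrace T)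
    {τ : Λ ⊗[K] Λᵐᵒᵖ →ₗ[K] K} (hτ : ∀ y e, τ (envDiff K y * e) = 0) :
    ∃ l : Λ, ∀ e : Λ ⊗[K] Λᵐᵒᵖ, τ e = T (e • l) := by
  obtain ⟨l, hl⟩ := hT.exists_repr (τ ∘ₗ (TensorProduct.mk K Λ Λᵐᵒᵖ).flip 1)
  replace hl : ∀ x, T (l * x) = τ (x ⊗ₜ 1) := hl
  suffices τ = T ∘ₗ (LinearMap.toSpanSingleton (Λ ⊗[K] Λᵐᵒᵖ) Λ l).restrictScalars K from
    ⟨l, LinearMap.congr_fun this⟩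
  refine TensorProduct.ext' fun a b => ?_
  obtain ⟨b, rfl⟩ := op_surjective b
  have h : τ ((b * a) ⊗ₜ 1 - a ⊗ₜ op b) = 0 := by
    simpa [envDiff_apply, sub_mul] using hτ b (a ⊗ₜ 1)
  rw [map_sub, sub_eq_zero, ← hl, ← mul_assoc, hT.comm, ← mul_assoc] at h
  rw [← h, LinearMap.comp_apply, LinearMap.restrictScalars_apply,
    LinearMap.toSpanSingleton_apply, tmul_op_smul]

theorem IsSymmetrizingTrace.exists_extend_of_derivationsInner (hT : IsSymmetrizingTrace T)
    (hder : DerivationsInner ε' ε) (θ : RingHom.ker (envChar ε ε') →ₗ[Λ ⊗[K] Λᵐᵒᵖ] Λ) :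
    ∃ τ : Λ ⊗[K] Λᵐᵒᵖ →ₗ[K] K,
      (∀ e : RingHom.ker (envChar ε ε'), τ e = T (θ e)) ∧ ∀ y e, τ (envDiff K y * e) = 0 := by
  let J := RingHom.ker (envChar ε ε')
  obtain ⟨t, ht⟩ := LinearMap.exists_extend (p := J.restrictScalars K) (T ∘ₗ θ.restrictScalars K)
  replace ht : ∀ e : J, t e = T (θ e) := LinearMap.congr_fun ht
  have hdiff : ∀ y e, t (envDiff K y * e) = envChar ε ε' e * t (envDiff K y) := by
    intro y e
    let j : J := ⟨e - algebraMap K _ (envChar ε ε' e), by simp [J, RingHom.mem_ker]⟩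
    have h : t (envDiff K y * j) = 0 := by
      rw [← smul_eq_mul, ← Submodule.coe_smul, ht, map_smul, envDiff_smul, map_sub, hT.comm,
        sub_self]
    rwa [mul_sub, map_sub, ← Algebra.commutes, ← Algebra.smul_def, map_smul, sub_eq_zero] at h
  obtain ⟨c, hc⟩ := hder (t ∘ₗ envDiff K) fun x y => by
    simp only [LinearMap.comp_apply, envDiff_mul_right, map_add, hdiff]
    simp [add_comm]
  refine ⟨t + c • (envChar ε ε').toLinearMap, fun e => ?_, fun y e => ?_⟩
  · simp [ht, RingHom.mem_ker.1 e.2]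
  · have hy : t (envDiff K y) = c * (ε' y - ε y) := hc y
    simp only [LinearMap.add_apply, LinearMap.smul_apply, AlgHom.toLinearMap_apply, hdiff, hy,
      map_mul, envChar_envDiff, smul_eq_mul]
    ring

theorem IsSymmetrizingTrace.isBaerAt_ker_envChar (hT : IsSymmetrizingTrace T)
    (hder : DerivationsInner ε' ε) : IsBaerAt (RingHom.ker (envChar ε ε')) Λ := by
  intro θ
  obtain ⟨τ, hτθ, hτ⟩ := hT.exists_extend_of_derivationsInner hder θ
  obtain ⟨l, hl⟩ := hT.exists_apply_smul_eq hτ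
  refine ⟨l, fun e => hT.ext fun z => ?_⟩
  have hz : ∀ x : Λ, T (x * z) = T ((z ⊗ₜ[K] op (1 : Λ)) • x) := fun x => by
    rw [tmul_op_smul, mul_one, hT.comm]
  rw [hz, hz, ← map_smul, ← hτθ, hl, Submodule.coe_smul, smul_eq_mul, mul_smul]

end Enveloping

/-! ### Comparing a presentation with a bimodule resolution -/

section ProjectiveSum

variable {E P B C : Type*} [Ring E] [AddCommGroup P] [Module E P] [Module.Projective E P]
  [AddCommGroup B] [AddCommGroup C]

/-- The additive map sending `x = ∑ eᵢ • yᵢ`, written through a chosen section of the free cover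
of `P`, to `∑ F yᵢ eᵢ`. It replaces linear extension when the target carries no `E`-module
structure. -/
noncomputable def projectiveSum (F : P → E →+ B) : P →+ B :=
  (Finsupp.liftAddHom F).comp
    (Module.projective_def'.1 ‹Module.Projective E P›).choose.toAddMonoidHom

theorem map_projectiveSum {F : P → E →+ B} (q : B →+ C) (g : P →+ C)
    (h : ∀ y e, q (F y e) = g (e • y)) (x : P) : q (projectiveSum F x) = g x := by
  have hσ := (Module.projective_def'.1 ‹Module.Projective E P›).choose_spec
  conv_rhs => rw [← LinearMap.id_apply (R := E) x, ← hσ]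
  simp [projectiveSum, Finsupp.liftAddHom_apply, Finsupp.linearCombination_apply, Finsupp.sum, h]

theorem map_projectiveSum_smul {F : P → E →+ B} (q r : B →+ C) {e : E}
    (h : ∀ y c, q (F y (e * c)) = r (F y c)) (x : P) :
    q (projectiveSum F (e • x)) = r (projectiveSum F x) := by
  simp only [projectiveSum, AddMonoidHom.comp_apply, LinearMap.toAddMonoidHom_coe, map_smul,
    Finsupp.liftAddHom_apply]
  rw [Finsupp.sum_smul_index fun _ => map_zero _]
  simp only [Finsupp.sum, map_sum, h]

end ProjectiveSum

section Comparison

variable {K Λ A : Type*} [Field K] [Ring Λ] [Algebra K Λ] [Ring A] [Algebra K A]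

attribute [local instance] instModuleTensorProductMop

/-- A functional on `A` whose restriction to the ideal `ker π` is a bimodule map into the simple
bimodule attached to the characters `ε` and `ε'`. -/
structure IsEquivariantOnKer (ε ε' : Λ →ₐ[K] K) (π : A →ₐ[K] Λ) (φ : A →ₗ[K] K) : Prop where
  mul_left : ∀ x r, π r = 0 → φ (x * r) = ε (π x) * φ r
  mul_right : ∀ r x, π r = 0 → φ (r * x) = φ r * ε' (π x)

variable {P₀ P₁ : Type*} [AddCommGroup P₀] [AddCommGroup P₁] [Module (Λ ⊗[K] Λᵐᵒᵖ) P₀]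
  [Module (Λ ⊗[K] Λᵐᵒᵖ) P₁]

/-- A comparison, after applying the character `ε` on the left, of the start `P₁ → P₀ → Λ` of a
bimodule resolution with the presentation `A → Λ`, where linearity of the second map `H` is only
required after composition with the functional `φ`. -/
structure IsComparison (ε : Λ →ₐ[K] K) (π : A →ₐ[K] Λ) (φ : A →ₗ[K] K)
    (d : P₁ →ₗ[Λ ⊗[K] Λᵐᵒᵖ] P₀) (p : P₀ →ₗ[Λ ⊗[K] Λᵐᵒᵖ] Λ) (G : P₀ →+ Λ) (H : P₁ →+ A) :
    Prop where
  char_apply : ∀ x, ε (G x) = ε (p x)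
  apply_smul : ∀ (e : Λ ⊗[K] Λᵐᵒᵖ) x, G (e • x) = G x * (envRight ε e).unop
  proj_apply : ∀ x, π (H x) = G (d x)
  functional_smul : ∀ (e : Λ ⊗[K] Λᵐᵒᵖ) x a, π a = (envRight ε e).unop →
    φ (H (e • x)) = φ (H x * a)

variable {ε ε' : Λ →ₐ[K] K} {π : A →ₐ[K] Λ} {φ : A →ₗ[K] K} {d : P₁ →ₗ[Λ ⊗[K] Λᵐᵒᵖ] P₀}
  {p : P₀ →ₗ[Λ ⊗[K] Λᵐᵒᵖ] Λ} {G : P₀ →+ Λ} {H : P₁ →+ A}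

theorem exists_augmentation_lift [Module.Projective (Λ ⊗[K] Λᵐᵒᵖ) P₀] (ε : Λ →ₐ[K] K)
    (p : P₀ →ₗ[Λ ⊗[K] Λᵐᵒᵖ] Λ) :
    ∃ G : P₀ →+ Λ, (∀ x, ε (G x) = ε (p x)) ∧
      ∀ (e : Λ ⊗[K] Λᵐᵒᵖ) x, G (e • x) = G x * (envRight ε e).unop := by
  let F (y : P₀) : Λ ⊗[K] Λᵐᵒᵖ →+ Λ :=
    (LinearMap.toAddMonoidHom (ε (p y) • (opLinearEquiv K).symm.toLinearMap)).comp
      (envRight ε : Λ ⊗[K] Λᵐᵒᵖ →+ Λᵐᵒᵖ)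
  have hF : ∀ y e, F y e = ε (p y) • (envRight ε e).unop := fun _ _ => rfl
  refine ⟨projectiveSum F, fun x => ?_, fun e x => ?_⟩
  · refine map_projectiveSum (ε : Λ →+ K) ((ε : Λ →+ K).comp p.toAddMonoidHom) (fun y e => ?_) x
    change ε (F y e) = ε (p (e • y))
    rw [hF, map_smul, char_unop_envRight, map_smul, char_smul, smul_eq_mul, mul_comm]
  · refine map_projectiveSum_smul (AddMonoidHom.id Λ)
      (AddMonoidHom.mulRight (envRight ε e).unop) (fun y c => ?_) x
    simp [hF]

theorem exists_isComparison [Module.Projective (Λ ⊗[K] Λᵐᵒᵖ) P₀]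
    [Module.Projective (Λ ⊗[K] Λᵐᵒᵖ) P₁] (hπ : Function.Surjective π)
    (hφ : IsEquivariantOnKer ε ε' π φ) (hdp : ∀ x, p (d x) = 0) :
    ∃ G H, IsComparison ε π φ d p G H := by
  obtain ⟨G, hG, hG'⟩ := exists_augmentation_lift ε p
  obtain ⟨τ, hτ⟩ := π.toLinearMap.exists_rightInverse_of_surjective (LinearMap.range_eq_top.2 hπ)
  replace hτ : ∀ x, π (τ x) = x := LinearMap.congr_fun hτ
  choose w hw using fun y => hπ (G (d y))
  let F (y : P₁) : Λ ⊗[K] Λᵐᵒᵖ →+ A :=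
    (LinearMap.toAddMonoidHom (LinearMap.mulLeft K (w y) ∘ₗ τ ∘ₗ
      (opLinearEquiv K).symm.toLinearMap)).comp (envRight ε : Λ ⊗[K] Λᵐᵒᵖ →+ Λᵐᵒᵖ)
  have hF : ∀ y e, F y e = w y * τ (envRight ε e).unop := fun _ _ => rfl
  refine ⟨G, projectiveSum F, hG, hG', fun x => ?_, fun e x a ha => ?_⟩
  · refine map_projectiveSum (π : A →+ Λ) (G.comp d.toAddMonoidHom) (fun y e => ?_) x
    change π (F y e) = G (d (e • y))
    rw [hF, map_mul, hw, hτ, map_smul, hG']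
  · refine map_projectiveSum_smul (φ : A →+ K) ((φ : A →+ K).comp (AddMonoidHom.mulRight a))
      (fun y c => ?_) x
    change φ (F y (e * c)) = φ (F y c * a)
    have hker : π (τ (envRight ε (e * c)).unop - τ (envRight ε c).unop * a) = 0 := by
      rw [map_sub, map_mul π, hτ, hτ, ha, map_mul, unop_mul, sub_self]
    rw [hF, hF, ← sub_eq_zero, ← map_sub, mul_assoc, ← mul_sub, hφ.mul_left _ _ hker, hw, hG, hdp,
      map_zero, zero_mul]

namespace IsComparison

theorem functional_eq_zero_of_mem_smul_ker (h : IsComparison ε π φ d p G H)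
    (hπ : Function.Surjective π) (hφ : IsEquivariantOnKer ε ε' π φ) {x : P₁}
    (hx : x ∈ RingHom.ker (envChar ε ε') • LinearMap.ker d) : φ (H x) = 0 := by
  refine Submodule.smul_induction_on hx (fun e he y hy => ?_) fun x y hx hy => ?_
  · obtain ⟨a, ha⟩ := hπ (envRight ε e).unop
    have hHy : π (H y) = 0 := by rw [h.proj_apply, LinearMap.mem_ker.1 hy, map_zero]
    rw [h.functional_smul e y a ha, hφ.mul_right _ _ hHy, ha, char_unop_envRight,
      RingHom.mem_ker.1 he, mul_zero]
  · rw [map_add, map_add, hx, hy, add_zero]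

theorem functional_mul (h : IsComparison ε π φ d p G H) (hφ : IsEquivariantOnKer ε ε' π φ)
    {u : P₀} {w x y : A} (hw : π w = G u) (hx : ε (π x) = 0) (hy : ε' (π y) = 0) {X Y : P₁}
    (hX : d X = envDiff K (π x) • u) :
    φ (H ((π x ⊗ₜ[K] op (1 : Λ)) • Y + ((1 : Λ) ⊗ₜ[K] op (π y)) • X)) = -φ (w * (x * y)) := by
  have hker : π (H X + w * x) = 0 := by
    rw [map_add, h.proj_apply, hX, h.apply_smul, map_mul, hw, envRight_envDiff, hx]
    simp
  have hφker : φ ((H X + w * x) * y) = 0 := by rw [hφ.mul_right _ _ hker, hy, mul_zero]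
  rw [map_add, map_add, h.functional_smul _ Y 0 (by simp [hx]), h.functional_smul _ X y (by simp),
    mul_zero, map_zero, zero_add, eq_neg_iff_add_eq_zero, ← map_add, ← mul_assoc, ← add_mul, hφker]

theorem exists_lift_envDiff (h : IsComparison ε π φ d p G H) (hφ : IsEquivariantOnKer ε ε' π φ)
    (hdp : Function.Exact d p) {u : P₀} (hu : p u = 1) {w : A} (hw : π w = G u) {ρ : A}
    (hρ : ρ ∈ LinearMap.ker (ε.comp π).toLinearMap * LinearMap.ker (ε'.comp π).toLinearMap) :
    ∃ X ∈ RingHom.ker (envChar ε ε') • (⊤ : Submodule (Λ ⊗[K] Λᵐᵒᵖ) P₁),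
      d X = envDiff K (π ρ) • u ∧ φ (H X) = -φ (w * ρ) := by
  have hdiff : ∀ a, ∃ X, d X = envDiff K a • u := fun a => (hdp _).1 <| by
    rw [map_smul, envDiff_smul, hu, mul_one, one_mul, sub_self]
  induction hρ using Submodule.mul_induction_on' with
  | mem_mul_mem x hx y hy =>
    replace hx : ε (π x) = 0 := hx
    replace hy : ε' (π y) = 0 := hy
    obtain ⟨X, hX⟩ := hdiff (π x)
    obtain ⟨Y, hY⟩ := hdiff (π y)
    refine ⟨_, add_mem (Submodule.smul_mem_smul ?_ Submodule.mem_top)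
      (Submodule.smul_mem_smul ?_ Submodule.mem_top), ?_, h.functional_mul hφ hw hx hy hX (Y := Y)⟩
    · simp [RingHom.mem_ker, hx]
    · simp [RingHom.mem_ker, hy]
    · rw [map_add, map_smul, map_smul, hX, hY, smul_smul, smul_smul, ← add_smul, map_mul,
        envDiff_mul_left, op_one]
  | add x _ y _ hx hy =>
    obtain ⟨X, hXJ, hX, hHX⟩ := hx
    obtain ⟨Y, hYJ, hY, hHY⟩ := hy
    refine ⟨X + Y, add_mem hXJ hYJ, ?_, ?_⟩
    · rw [map_add, hX, hY, map_add, map_add, add_smul]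
    · rw [map_add, map_add, hHX, hHY, mul_add, map_add, neg_add]

end IsComparison

theorem IsEquivariantOnKer.apply_eq_zero [Module.Projective (Λ ⊗[K] Λᵐᵒᵖ) P₀]
    [Module.Projective (Λ ⊗[K] Λᵐᵒᵖ) P₁] (hφ : IsEquivariantOnKer ε ε' π φ)
    (hπ : Function.Surjective π) (hdp : Function.Exact d p) (hp : Function.Surjective p)
    (hd : ∀ x ∈ LinearMap.ker d,
      x ∈ RingHom.ker (envChar ε ε') • (⊤ : Submodule (Λ ⊗[K] Λᵐᵒᵖ) P₁) →
        x ∈ RingHom.ker (envChar ε ε') • LinearMap.ker d)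
    {ρ : A} (hρ : π ρ = 0)
    (hρ' : ρ ∈ LinearMap.ker (ε.comp π).toLinearMap * LinearMap.ker (ε'.comp π).toLinearMap) :
    φ ρ = 0 := by
  obtain ⟨G, H, h⟩ := exists_isComparison hπ hφ hdp.apply_apply_eq_zero
  obtain ⟨u, hu⟩ := hp 1
  obtain ⟨w, hw⟩ := hπ (G u)
  obtain ⟨X, hXJ, hX, hHX⟩ := h.exists_lift_envDiff hφ hdp hu hw hρ'
  have hXd : X ∈ LinearMap.ker d := by
    rw [LinearMap.mem_ker, hX, hρ, map_zero]
    exact zero_smul (Λ ⊗[K] Λᵐᵒᵖ) u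
  have hwρ : φ (w * ρ) = 0 := by
    rw [← neg_eq_zero, ← hHX, h.functional_eq_zero_of_mem_smul_ker hπ hφ (hd X hXd hXJ)]
  rwa [hφ.mul_left _ _ hρ, hw, h.char_apply, hu, map_one, one_mul] at hwρ

end Comparison

/-! ### Bimodules of period four -/

section PeriodFour

theorem IsSyzygy.exists_exact.{u} {E : Type u} [Ring E] {M N : Type u} [AddCommGroup M] [Module E M]
    [AddCommGroup N] [Module E N] (h : IsSyzygy E M N) :
    ∃ (P : Type u) (_ : AddCommGroup P) (_ : Module E P) (ι : N →ₗ[E] P) (π : P →ₗ[E] M),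
      Module.Projective E P ∧ Function.Injective ι ∧ Function.Exact ι π ∧
        Function.Surjective π := by
  obtain ⟨P, _, _, π, hP, hπ, -, ⟨e⟩⟩ := h
  refine ⟨P, _, _, (LinearMap.ker π).subtype ∘ₗ e.toLinearMap, π, hP,
    Subtype.val_injective.comp e.injective, fun x => ⟨fun hx => ⟨e.symm ⟨x, hx⟩, by simp⟩, ?_⟩, hπ⟩
  rintro ⟨y, rfl⟩
  exact (e y).2

universe u

variable {K A : Type*} {Λ : Type u} [Field K] [Ring Λ] [Algebra K Λ] [Ring A] [Algebra K A]

attribute [local instance] instModuleTensorProductMop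

theorem IsNthSyzygy.functional_eq_zero [Module.Finite K Λ]
    (h : IsNthSyzygy (Λ ⊗[K] Λᵐᵒᵖ) 4 Λ Λ) {T : Λ →ₗ[K] K} (hT : IsSymmetrizingTrace T)
    {ε ε' : Λ →ₐ[K] K} (hder : DerivationsInner ε' ε) {π : A →ₐ[K] Λ}
    (hπ : Function.Surjective π) {φ : A →ₗ[K] K} (hφ : IsEquivariantOnKer ε ε' π φ)
    {ρ : A} (hρ : π ρ = 0)
    (hρ' : ρ ∈ LinearMap.ker (ε.comp π).toLinearMap * LinearMap.ker (ε'.comp π).toLinearMap) :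
    φ ρ = 0 := by
  obtain ⟨s, hs⟩ := (hT.dualDistrib_tmul hT.comp_unop).exists_isAnnihilatorPair_ker (envChar ε ε')
  obtain ⟨L₃, _, _, ⟨L₂, _, _, ⟨L₁, _, _, ⟨L₀, _, _, ⟨e₀⟩, h₀⟩, h₁⟩, h₂⟩, h₃⟩ := h
  obtain ⟨P₀, _, _, ι₀, π₀, _, hι₀, hex₀, hπ₀⟩ := h₀.exists_exact
  obtain ⟨P₁, _, _, ι₁, π₁, _, hι₁, hex₁, hπ₁⟩ := h₁.exists_exact
  obtain ⟨P₂, _, _, ι₂, π₂, _, hι₂, hex₂, hπ₂⟩ := h₂.exists_exact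
  obtain ⟨P₃, _, _, ι₃, π₃, _, hι₃, hex₃, hπ₃⟩ := h₃.exists_exact
  have hL₂ : ∀ x : L₂, s • x = 0 → x ∈ RingHom.ker (envChar ε ε') • ⊤ := fun x hx =>
    hs.mem_smul_top_of_exact hι₂ hex₂ hπ₂ (fun m hm =>
      (hT.isBaerAt_ker_envChar hder).exists_eq_smul_of_exact hs hι₃ hex₃ hπ₃ hm) hx
  have hd : LinearMap.ker (ι₀ ∘ₗ π₁) = LinearMap.range ι₁ := by
    rw [LinearMap.ker_comp_of_ker_eq_bot _ (LinearMap.ker_eq_bot.2 hι₀), hex₁.linearMap_ker_eq]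
  have hdp : Function.Exact (ι₀ ∘ₗ π₁) (e₀.toLinearMap ∘ₗ π₀) :=
    (hπ₁.comp_exact_iff_exact.2 hex₀).comp_injective _ e₀.injective (map_zero e₀)
  exact hφ.apply_eq_zero hπ hdp (e₀.surjective.comp hπ₀)
    (fun x hx hxJ => hd ▸ hs.mem_smul_range hι₁ hL₂ (hd ▸ hx) hxJ) hρ hρ'

end PeriodFour

/-! ### Vertices and arrows of the path algebra -/

namespace PathAlgebra

variable {K : Type*} [Field K] {V : Type*} [Quiver V]

theorem hom_ext {M : Type*} [AddCommGroup M] [Module K M] {f g : PathAlgebra K V →ₗ[K] M}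
    (h : ∀ (a b : V) (p : Quiver.Path a b), f (ofPath K p) = g (ofPath K p)) : f = g :=
  Finsupp.lhom_ext' fun q => LinearMap.ext_ring (h q.1 q.2.1 q.2.2)

variable (K) in
/-- The idempotent of the path algebra given by the path of length zero at a vertex. -/
noncomputable def idem (k : V) : PathAlgebra K V := ofPath K (.nil : Quiver.Path k k)

theorem idem_mul_ofPath {a b : V} (p : Quiver.Path a b) : idem K a * ofPath K p = ofPath K p := by
  rw [idem, ofPath_mul_comp, Quiver.Path.nil_comp]

theorem ofPath_mul_idem {a b : V} (p : Quiver.Path a b) : ofPath K p * idem K b = ofPath K p := by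
  rw [idem, ofPath_mul_comp, Quiver.Path.comp_nil]

theorem idem_mul_idem_self (k : V) : idem K k * idem K k = idem K k :=
  idem_mul_ofPath _

theorem idem_mul_idem_of_ne {k l : V} (h : k ≠ l) : idem K k * idem K l = 0 :=
  ofPath_mul_of_ne _ _ h

theorem ofPath_cons {a b c : V} (p : Quiver.Path a b) (α : b ⟶ c) :
    ofPath K (p.cons α) = ofPath K p * ofPath K α.toPath :=
  (ofPath_mul_comp p α.toPath).symm

theorem ofPath_cons_mem_arrowIdeal {a b c : V} (p : Quiver.Path a b) (α : b ⟶ c) :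
    ofPath K (p.cons α) ∈ arrowIdeal K V :=
  Submodule.subset_span ⟨a, c, p.cons α, by simp, rfl⟩

theorem idem_mul_mul_idem_of_support {a b : V} {x : PathAlgebra K V}
    (hx : ∀ (c d : V) (p : Quiver.Path c d), x.coeff p ≠ 0 → c = a ∧ d = b) :
    idem K a * x * idem K b = x := by
  have hsum : x = ∑ q ∈ Finsupp.support (M := K) x, x.coeff q.2.2 • ofPath K q.2.2 := by
    conv_lhs => rw [← Finsupp.sum_single (M := K) x]
    refine Finset.sum_congr rfl fun q _ => ?_
    exact (Finsupp.smul_single_one q _).symm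
  conv_lhs => rw [hsum]
  conv_rhs => rw [hsum]
  rw [mul_sum_aux, sum_mul_aux]
  refine Finset.sum_congr rfl fun ⟨c, d, p⟩ hq => ?_
  obtain ⟨rfl, rfl⟩ := hx c d p (Finsupp.mem_support_iff.1 hq)
  rw [mul_smul_aux, smul_mul_aux, idem_mul_ofPath, ofPath_mul_idem]

variable (K) in
/-- The coefficient of the path of length zero at a vertex, as a linear form. -/
noncomputable def vertexForm (k : V) : PathAlgebra K V →ₗ[K] K :=
  Finsupp.lapply (⟨k, k, .nil⟩ : QPath V)

theorem vertexForm_idem [DecidableEq V] (k l : V) :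
    vertexForm K k (idem K l) = if l = k then 1 else 0 := by
  split_ifs with h
  · exact h ▸ Finsupp.single_eq_same
  · exact Finsupp.single_eq_of_ne fun hkl => h (congrArg Sigma.fst hkl).symm

theorem vertexForm_ofPath_cons (k : V) {a b c : V} (p : Quiver.Path a b) (α : b ⟶ c) :
    vertexForm K k (ofPath K (p.cons α)) = 0 := by
  rw [vertexForm, ofPath]
  refine Finsupp.single_eq_of_ne fun h => ?_
  have := congrArg (fun q : QPath V => q.2.2.length) h
  simp at this

theorem vertexForm_mul (k : V) (x y : PathAlgebra K V) :
    vertexForm K k (x * y) = vertexForm K k x * vertexForm K k y := by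
  classical
  suffices h : (mulHom K V).compr₂ (vertexForm K k) =
      (LinearMap.mul K K).compl₁₂ (vertexForm K k) (vertexForm K k) from
    LinearMap.congr_fun₂ h x y
  refine hom_ext fun a b p => hom_ext fun c d q => ?_
  change vertexForm K k (ofPath K p * ofPath K q) = _ * _
  by_cases hbc : b = c
  · subst hbc
    rw [ofPath_mul_comp]
    cases q with
    | cons q α =>
      rw [Quiver.Path.comp_cons, vertexForm_ofPath_cons, vertexForm_ofPath_cons, mul_zero]
    | nil =>
      rw [Quiver.Path.comp_nil, ← idem]
      cases p with
      | cons p α => rw [vertexForm_ofPath_cons, zero_mul]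
      | nil => rw [← idem, vertexForm_idem, mul_ite, mul_one, mul_zero]; split_ifs <;> rfl
  · rw [ofPath_mul_of_ne _ _ hbc, map_zero]
    cases q with
    | cons q α => rw [vertexForm_ofPath_cons, mul_zero]
    | nil =>
      cases p with
      | cons p α => rw [vertexForm_ofPath_cons, zero_mul]
      | nil =>
        rw [← idem, ← idem, vertexForm_idem, vertexForm_idem]
        split_ifs with ha hc
        · exact absurd (ha.trans hc.symm) hbc
        all_goals simp

variable [Fintype V]

variable (K) in
/-- The character of the path algebra attached to a vertex, which is the action on the simple module
at this vertex. -/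
noncomputable def vertexChar (k : V) : PathAlgebra K V →ₐ[K] K :=
  AlgHom.ofLinearMap (vertexForm K k) (by
    classical
    change vertexForm K k (∑ l, idem K l) = 1
    simp [vertexForm_idem]) (vertexForm_mul k)

@[simp]
theorem vertexChar_idem [DecidableEq V] (k l : V) :
    vertexChar K k (idem K l) = if l = k then 1 else 0 :=
  vertexForm_idem k l

@[simp]
theorem vertexChar_ofPath_cons (k : V) {a b c : V} (p : Quiver.Path a b) (α : b ⟶ c) :
    vertexChar K k (ofPath K (p.cons α)) = 0 :=
  vertexForm_ofPath_cons k p α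

theorem mem_arrowIdeal_iff {x : PathAlgebra K V} :
    x ∈ arrowIdeal K V ↔ ∀ k, vertexChar K k x = 0 := by
  classical
  refine ⟨fun hx k => ?_, fun hx => ?_⟩
  · refine LinearMap.mem_ker.1 ((Submodule.span_le (p := LinearMap.ker (vertexForm K k))).2 ?_ hx)
    rintro _ ⟨a, b, p, hp, rfl⟩
    cases p with
    | nil => simp at hp
    | cons p α => exact vertexForm_ofPath_cons k p α
  · have hmk : (arrowIdeal K V).mkQ = ∑ k, (vertexForm K k).smulRight
        ((arrowIdeal K V).mkQ (idem K k)) := hom_ext fun a b p => by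
      simp only [LinearMap.sum_apply, LinearMap.smulRight_apply]
      cases p with
      | nil =>
        rw [← idem]
        simp only [vertexForm_idem, ite_smul, one_smul, zero_smul, Finset.sum_ite_eq,
          Finset.mem_univ, if_true]
      | cons p α => simpa [vertexForm_ofPath_cons] using ofPath_cons_mem_arrowIdeal p α
    rw [← Submodule.ker_mkQ (arrowIdeal K V), hmk, LinearMap.mem_ker, LinearMap.sum_apply]
    exact Finset.sum_eq_zero fun k _ => (congrArg (· • _) (hx k)).trans (zero_smul K _)

theorem idem_mul_sub_mem_arrowIdeal (k : V) (x : PathAlgebra K V) :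
    idem K k * x - vertexChar K k x • idem K k ∈ arrowIdeal K V := by
  classical
  refine mem_arrowIdeal_iff.2 fun l => ?_
  rcases eq_or_ne k l with rfl | hkl <;> simp [*]

theorem mul_idem_sub_mem_arrowIdeal (k : V) (x : PathAlgebra K V) :
    x * idem K k - vertexChar K k x • idem K k ∈ arrowIdeal K V := by
  classical
  refine mem_arrowIdeal_iff.2 fun l => ?_
  rcases eq_or_ne k l with rfl | hkl <;> simp [*]

theorem derivation_eq_zero {i j : V} [IsEmpty (j ⟶ i)] {D : PathAlgebra K V →ₗ[K] K}
    (hD : ∀ x y, D (x * y) = vertexChar K j x * D y + vertexChar K i y * D x)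
    (hj : D (idem K j) = 0) : D = 0 := by
  classical
  have hidem_ne : ∀ a, a ≠ j → D (idem K a) = 0 := fun a ha => by
    have h := hD (idem K j) (idem K a)
    simpa [idem_mul_idem_of_ne ha.symm, hj, eq_comm] using h
  have hidem : ∀ a, D (idem K a) = 0 := fun a => by
    rcases eq_or_ne a j with rfl | ha
    exacts [hj, hidem_ne a ha]
  have harrow : ∀ (b c : V) (α : b ⟶ c), vertexChar K j (idem K b) * D (ofPath K α.toPath) = 0 := by
    intro b c α
    rcases eq_or_ne b j with rfl | hb
    · have hc : c ≠ i := by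
        rintro rfl
        exact isEmptyElim α
      have h := hD (ofPath K α.toPath) (idem K c)
      rw [ofPath_mul_idem, hidem, vertexChar_idem, if_neg hc] at h
      simpa using h
    · rw [vertexChar_idem, if_neg hb, zero_mul]
  refine hom_ext fun a b p => ?_
  cases p with
  | nil => exact hidem a
  | cons p α =>
    rw [ofPath_cons, hD, Quiver.Hom.toPath, vertexChar_ofPath_cons, zero_mul, add_zero]
    cases p with
    | nil => exact harrow a b α
    | cons p β => rw [vertexChar_ofPath_cons, zero_mul, LinearMap.zero_apply]

theorem derivationsInner_vertexChar {i j : V} [IsEmpty (j ⟶ i)] :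
    DerivationsInner (vertexChar K j) (vertexChar K i) := by
  classical
  intro g hg
  let D := g - g (idem K j) • ((vertexChar K j).toLinearMap - (vertexChar K i).toLinearMap)
  have hD : D = 0 := derivation_eq_zero (i := i) (j := j) (fun x y => ?_) ?_
  · exact ⟨g (idem K j), fun x => sub_eq_zero.1 (LinearMap.congr_fun hD x)⟩
  · simp only [D, LinearMap.sub_apply, LinearMap.smul_apply, AlgHom.toLinearMap_apply, map_mul, hg,
      smul_eq_mul]
    ring
  · have h := hg (idem K j) (idem K j)
    rw [idem_mul_idem_self, vertexChar_idem, if_pos rfl] at h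
    simp only [D, LinearMap.sub_apply, LinearMap.smul_apply, AlgHom.toLinearMap_apply,
      vertexChar_idem, if_pos, smul_eq_mul] at h ⊢
    linear_combination -h

theorem arrowIdeal_sq_le : arrowIdeal K V ^ 2 ≤ arrowIdeal K V := by
  rw [pow_two, Submodule.mul_le]
  intro x hx y _
  refine mem_arrowIdeal_iff.2 fun k => ?_
  rw [map_mul, mem_arrowIdeal_iff.1 hx, zero_mul]

theorem exists_comp_mkₐ_eq_vertexChar {I : Ideal (PathAlgebra K V)} [I.IsTwoSided]
    (hI : I.restrictScalars K ≤ arrowIdeal K V) (k : V) :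
    ∃ ε : PathAlgebra K V ⧸ I →ₐ[K] K, ε.comp (Ideal.Quotient.mkₐ K I) = vertexChar K k :=
  ⟨Ideal.Quotient.liftₐ I (vertexChar K k) fun _ hx => mem_arrowIdeal_iff.1 (hI hx) k,
    Ideal.Quotient.liftₐ_comp I _ _⟩

end PathAlgebra

/-! ### Minimal relations -/

section MinimalRelations

open PathAlgebra

theorem IsMinimalRelation.exists_isEquivariantOnKer {K : Type*} [Field K] {V : Type*} [Quiver V]
    [Fintype V] {I : Ideal (PathAlgebra K V)} [I.IsTwoSided] {a b : V} {ρ : PathAlgebra K V}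
    (hρ : IsMinimalRelation I a b ρ) {ε ε' : PathAlgebra K V ⧸ I →ₐ[K] K}
    (hε : ε.comp (Ideal.Quotient.mkₐ K I) = vertexChar K a)
    (hε' : ε'.comp (Ideal.Quotient.mkₐ K I) = vertexChar K b) :
    ∃ ψ : PathAlgebra K V →ₗ[K] K,
      IsEquivariantOnKer ε ε' (Ideal.Quotient.mkₐ K I) ψ ∧ ψ ρ ≠ 0 := by
  obtain ⟨-, hρab, hρmin⟩ := hρ
  obtain ⟨φ, hφρ, hφ⟩ := Submodule.exists_le_ker_of_notMem hρmin
  have hφIR : ∀ r ∈ I, ∀ x ∈ arrowIdeal K V, φ (r * x) = 0 := fun r hr x hx =>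
    hφ (Submodule.mem_sup_left (Submodule.mul_mem_mul hr hx))
  have hφRI : ∀ x ∈ arrowIdeal K V, ∀ r ∈ I, φ (x * r) = 0 := fun x hx r hr =>
    hφ (Submodule.mem_sup_right (Submodule.mul_mem_mul hx hr))
  refine ⟨φ ∘ₗ LinearMap.mulRight K (idem K b) ∘ₗ LinearMap.mulLeft K (idem K a),
    ⟨fun x r hr => ?_, fun r x hr => ?_⟩, ?_⟩
  · change φ (idem K a * (x * r) * idem K b) =
      ε.comp (Ideal.Quotient.mkₐ K I) x * φ (idem K a * r * idem K b)
    have h := hφRI _ (idem_mul_sub_mem_arrowIdeal a x) _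
      (I.mul_mem_right (idem K b) (Ideal.Quotient.eq_zero_iff_mem.1 hr))
    rw [sub_mul, map_sub, smul_mul_assoc, map_smul, sub_eq_zero, smul_eq_mul] at h
    simpa only [hε, mul_assoc] using h
  · change φ (idem K a * (r * x) * idem K b) =
      φ (idem K a * r * idem K b) * ε'.comp (Ideal.Quotient.mkₐ K I) x
    have h := hφIR _ (I.mul_mem_left (idem K a) (Ideal.Quotient.eq_zero_iff_mem.1 hr)) _
      (mul_idem_sub_mem_arrowIdeal b x)
    rw [mul_sub, map_sub, mul_smul_comm, map_smul, sub_eq_zero, smul_eq_mul] at h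
    simpa only [hε', mul_assoc, mul_comm] using h
  · change φ (idem K a * ρ * idem K b) ≠ 0
    rwa [idem_mul_mul_idem_of_support hρab]

attribute [local instance] instModuleTensorProductMop in
theorem lemma4p5_general {K : Type*} [Field K] {V : Type*} [Quiver V] [Fintype V]
    {I : Ideal (PathAlgebra K V)} [I.IsTwoSided] (hI : I.restrictScalars K ≤ arrowIdeal K V ^ 2)
    (hsymm : IsSymmetricAlg K (PathAlgebra K V ⧸ I))
    (hper : IsNthSyzygy ((PathAlgebra K V ⧸ I) ⊗[K] (PathAlgebra K V ⧸ I)ᵐᵒᵖ) 4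
      (PathAlgebra K V ⧸ I) (PathAlgebra K V ⧸ I))
    {a b : V} {ρ : PathAlgebra K V} (hρ : IsMinimalRelation I a b ρ) : Nonempty (b ⟶ a) := by
  by_contra hba
  rw [not_nonempty_iff] at hba
  have : Module.Finite K (PathAlgebra K V ⧸ I) := hsymm.1
  obtain ⟨T, hT⟩ := hsymm.exists_isSymmetrizingTrace
  obtain ⟨ε, hε⟩ := exists_comp_mkₐ_eq_vertexChar (hI.trans arrowIdeal_sq_le) a
  obtain ⟨ε', hε'⟩ := exists_comp_mkₐ_eq_vertexChar (hI.trans arrowIdeal_sq_le) b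
  have hder : DerivationsInner ε' ε :=
    .of_surjective (Ideal.Quotient.mkₐ_surjective K I) (hε ▸ hε' ▸ derivationsInner_vertexChar)
  obtain ⟨ψ, hψ, hψρ⟩ := hρ.exists_isEquivariantOnKer hε hε'
  refine hψρ (hper.functional_eq_zero hT hder (Ideal.Quotient.mkₐ_surjective K I) hψ
    (Ideal.Quotient.eq_zero_iff_mem.2 hρ.1) ?_)
  rw [hε, hε']
  have hker : ∀ k, arrowIdeal K V ≤ LinearMap.ker (vertexChar K k).toLinearMap :=
    fun k x hx => mem_arrowIdeal_iff.1 hx k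
  exact mul_le_mul' (hker a) (hker b) (pow_two (arrowIdeal K V) ▸ hI hρ.1)

end MinimalRelations

theorem lemma4p5 {K : Type*} [Field K] [IsAlgClosed K] {V : Type*} [Quiver V] [Fintype V]
    (hconn : QuiverConnected V) (hbis : QuiverBiserial V)
    (I : Ideal (PathAlgebra K V)) [I.IsTwoSided] (hI : IsAdmissible I)
    (hΛ : IsTSP4 K (PathAlgebra K V ⧸ I))
    {u i k t j : V} (δ : u ⟶ i) (α : i ⟶ k) (β : k ⟶ t) (γ : t ⟶ j)
    (h₂ : ¬ OccursInMinimalRelation I (α.toPath.comp β.toPath) ∨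
      ¬ OccursInMinimalRelation I (β.toPath.comp γ.toPath))
    (h₃ : OccursInMinimalRelation I ((α.toPath.comp β.toPath).comp γ.toPath)) :
    Nonempty (j ⟶ i) := by
  obtain ⟨ρ, hρ, -⟩ := h₃
  exact lemma4p5_general hI.1 hΛ.symmetric hΛ.periodic.1.2 hρ
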